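/- Let $\mathcal{A}$ be a finite alphabet, let $L\ge 2$, and let $\varrho\colon\mathcal{A}\to\mathcal{A}^{L}$ be a substitution of constant length $L$, extended to words by concatenation. Assume that $\varrho$ is primitive (for some $k\ge 1$, every word $\varrho^{k}(a)$, $a\in\mathcal{A}$, contains all letters of $\mathcal{A}$) and bijective (each column $\varrho_j\colon a\mapsto\varrho(a)_j$, $0\le j\le L-1$, is a bijection of $\mathcal{A}$). Let $\mathbb{X}_\varrho\subseteq\mathcal{A}^{\mathbb{Z}}$ be the subshift of all bi-infinite sequences each of whose finite subwords is a subword of $\varrho^{k}(a)$ for some $k\ge1$ and $a\in\mathcal{A}$, with the product topology and the shift $(\sigma x)_n=x_{n+1}$. Assume that $\varrho$ is aperiodic, i.e. no $x\in\mathbb{X}_\varrho$ satisfies $\sigma^{p}x=x$ for some $p\neq0$. Let $H\colon\mathbb{X}_\varrho\to\mathbb{X}_\varrho$ be a reversor, that is, a homeomorphism with $H\circ\sigma\circ H^{-1}=\sigma^{-1}$. Put $m(x)_n=x_{-n}$ and $m'(x)_n=x_{1-n}$ for $x\in\mathcal{A}^{\mathbb{Z}}$, and let $\mu=m$ if $L$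 is odd and $\mu=m'$ if $L$ is even. Then there are a permutation $\pi$ of $\mathcal{A}$ and an integer $k$ such that $$H(x)=\pi\bigl(\sigma^{k}(\mu(x))\bigr)\qquad\text{for all }x\in\mathbb{X}_\varrho,$$ where $\pi$ acts letter by letter. In particular, $H$ has radius zero up to a shift: there is an integer $h$ such that $(\sigma^{h}H(x))_0$ depends only on $x_0$, for $x\in\mathbb{X}_\varrho$. -/

import Mathlib

open SymbolicDynamics.FullShift (Subshift shift shift_apply continuous_shift)

/-- A substitution `ρ : A → A ^ L` of constant length `L`: the letter at position `j` of the word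
`ρ(a)` is `ρ a j`. -/
abbrev ConstLengthSubst (A : Type*) (L : ℕ) := A → Fin L → A

namespace ConstLengthSubst

variable {A : Type*} {L : ℕ}

/-- The extension of `ρ` to finite words, by concatenation. -/
def inflate (ρ : ConstLengthSubst A L) (w : List A) : List A :=
  w.flatMap fun a => List.ofFn (ρ a)

/-- The word `ρ^k(a)`. -/
def iter (ρ : ConstLengthSubst A L) (k : ℕ) (a : A) : List A :=
  (ρ.inflate)^[k] [a]

/-- Some power `ρ^k` is such that every word `ρ^k(a)` contains all letters. -/
def IsPrimitive (ρ : ConstLengthSubst A L) : Prop :=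
  ∃ k : ℕ, 1 ≤ k ∧ ∀ a b : A, b ∈ ρ.iter k a

/-- The `j`-th column of `ρ`, the map `a ↦ ρ(a)_j`. -/
def column (ρ : ConstLengthSubst A L) (j : Fin L) : A → A :=
  fun a => ρ a j

/-- All columns are bijections of the alphabet. -/
def IsBijective (ρ : ConstLengthSubst A L) : Prop :=
  ∀ j : Fin L, Function.Bijective (ρ.column j)

/-- The legal words: all subwords (contiguous) of the words `ρ^k(a)`, `k ≥ 1`. -/
def language (ρ : ConstLengthSubst A L) : Set (List A) :=
  {w | ∃ k : ℕ, 1 ≤ k ∧ ∃ a : A, w <:+: ρ.iter k a}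

/-- The word `x_n x_{n+1} … x_{n+m-1}` of the configuration `x`. -/
def wordAt (x : ℤ → A) (n : ℤ) (m : ℕ) : List A :=
  List.ofFn fun i : Fin m => x (n + (i : ℤ))

variable [TopologicalSpace A] [DiscreteTopology A]

/-- The substitutive subshift (hull) of `ρ`: the configurations all of whose finite subwords are
legal. -/
def hull (ρ : ConstLengthSubst A L) : Subshift A ℤ where
  carrier := {x | ∀ (n : ℤ) (m : ℕ), wordAt x n m ∈ ρ.language}
  isClosed := by
    simp only [Set.ofPred_forall]
    refine isClosed_iInter fun n => isClosed_iInter fun m => ?_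
    have hc : Continuous fun (x : ℤ → A) (i : Fin m) => x (n + (i : ℤ)) := by fun_prop
    exact (isClosed_discrete {u : Fin m → A | List.ofFn u ∈ ρ.language}).preimage hc
  mapsTo := by
    intro g x hx n m
    have h : wordAt (shift g x) n m = wordAt x (g + n) m := by
      simp [wordAt, add_assoc]
    rw [h]
    exact hx (g + n) m

end ConstLengthSubst

namespace SubshiftZ

variable {A : Type*} [TopologicalSpace A]

/-- No element of the subshift has a non-zero period. -/
def IsAperiodic (X : Subshift A ℤ) : Prop :=
  ∀ x ∈ X.carrier, ∀ p : ℤ, shift p x = x → p = 0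

/-- The left shift `(σ x)_n = x_{1 + n}` as a self-homeomorphism of the subshift. -/
def σ (X : Subshift A ℤ) : X.carrier ≃ₜ X.carrier where
  toFun x := ⟨shift 1 x.1, X.mapsTo 1 x.2⟩
  invFun x := ⟨shift (-1) x.1, X.mapsTo (-1) x.2⟩
  left_inv x := by ext n; simp
  right_inv x := by ext n; simp
  continuous_toFun := by
    exact ((continuous_shift 1).comp continuous_subtype_val).subtype_mk _
  continuous_invFun := by
    exact ((continuous_shift (-1)).comp continuous_subtype_val).subtype_mk _

/-- A reversor is a self-homeomorphism `H` of the subshift with `H ∘ σ ∘ H⁻¹ = σ⁻¹`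
(in the group of self-homeomorphisms, whose product is composition). -/
def IsReversor (X : Subshift A ℤ) (H : X.carrier ≃ₜ X.carrier) : Prop :=
  H * σ X * H⁻¹ = (σ X)⁻¹

/-- The letter of `H x` at the origin depends only on `x` restricted to `[-r, r]`. -/
def HasRadiusLE (X : Subshift A ℤ) (H : X.carrier ≃ₜ X.carrier) (r : ℕ) : Prop :=
  ∀ x y : X.carrier, (∀ i : ℤ, |i| ≤ (r : ℤ) → x.1 i = y.1 i) → (H x).1 0 = (H y).1 0

end SubshiftZ

/-- The letter exchange map on configurations induced by a permutation of the alphabet. -/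
def letterExchange {A : Type*} (π : Equiv.Perm A) (x : ℤ → A) : ℤ → A :=
  fun n => π (x n)

/-- The basic mirroring map `m(x)_n = x_{-n}`. -/
def mirror {A : Type*} (x : ℤ → A) : ℤ → A :=
  fun n => x (-n)

/-- The basic mirroring map `m'(x)_n = x_{1-n}`. -/
def mirror' {A : Type*} (x : ℤ → A) : ℤ → A :=
  fun n => x (1 - n)

/-- The basic mirroring map attached to the length `L`: `m` for odd `L` and `m'` for even `L`. -/
def basicMirror {A : Type*} (L : ℕ) : (ℤ → A) → (ℤ → A) :=
  if Odd L then mirror else mirror'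

open Function in
/-- A self-injection of a type that maps a finite set into itself permutes that set, so that the
set contains every point with some iterate in it. -/
theorem Function.Injective.mem_of_iterate_mem {α : Type*} {T : α → α} (hT : Injective T)
    {S : Set α} (hS : S.Finite) (hTS : Set.MapsTo T S S) {n : ℕ} {a : α} (ha : T^[n] a ∈ S) :
    a ∈ S := by
  have hsurj : Set.SurjOn T S S :=
    ((hS.injOn_iff_bijOn_of_mapsTo hTS).1 hT.injOn).surjOn
  obtain ⟨b, hb, hba⟩ := hsurj.iterate n ha
  rwa [← hT.iterate n hba]

/-- Pigeonhole principle for an antitone sequence of predicates. -/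
theorem Set.Finite.exists_forall_of_antitone {β : Type*} {F : Set β} (hF : F.Finite)
    {P : ℕ → β → Prop} (hP : ∀ m n b, m ≤ n → P n b → P m b) (h : ∀ n, ∃ b ∈ F, P n b) :
    ∃ b ∈ F, ∀ n, P n b := by
  by_contra! hc
  choose! N hN using hc
  obtain ⟨M, hM⟩ := (hF.image N).bddAbove
  obtain ⟨b, hb, hb'⟩ := h M
  exact hN b hb (hP _ _ b (hM ⟨b, hb, rfl⟩) hb')

namespace SubshiftZ

variable {A : Type*}

theorem shift_shift (s t : ℤ) (x : ℤ → A) : shift s (shift t x) = shift (s + t) x := by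
  ext i
  simp only [shift_apply]
  congr 1
  ring

theorem shift_zero (x : ℤ → A) : shift 0 x = x := by
  ext i
  simp [shift_apply]

/-- A configuration in which every letter determines the next one is periodic. -/
theorem exists_period_of_succ_eq [Finite A] {x : ℤ → A} {f : A → A}
    (h : ∀ j, x (j + 1) = f (x j)) : ∃ p : ℤ, p ≠ 0 ∧ shift p x = x := by
  obtain ⟨a, b, hab, hf⟩ := Finite.exists_ne_map_eq_of_infinite fun n : ℕ => f^[n]
  have hx : ∀ (n : ℕ) (j : ℤ), x (j + n) = f^[n] (x j) := by
    intro n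
    induction n with
    | zero => simp
    | succ n ih =>
      intro j
      rw [Function.iterate_succ_apply', ← ih, ← h]
      push_cast
      congr 1
      ring
  refine ⟨a - b, by omega, ?_⟩
  ext i
  have h1 := hx a (i - b)
  have h2 := hx b (i - b)
  rw [hf, ← h2] at h1
  rw [shift_apply]
  convert h1 using 2 <;> ring

section Topology

variable [TopologicalSpace A] [DiscreteTopology A]

omit [DiscreteTopology A] in
/-- Central windows form a neighbourhood basis in the full shift. -/
theorem exists_window_of_mem_nhds {x : ℤ → A} {U : Set (ℤ → A)} (hU : U ∈ nhds x) :
    ∃ N : ℕ, ∀ y : ℤ → A, (∀ i : ℤ, |i| ≤ N → y i = x i) → y ∈ U := by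
  obtain ⟨V, hVU, hV, hx⟩ := mem_nhds_iff.1 hU
  obtain ⟨I, u, hu, hI⟩ := isOpen_pi_iff.1 hV x hx
  refine ⟨I.sup Int.natAbs, fun y hy => hVU (hI fun i hi => ?_)⟩
  have : i.natAbs ≤ I.sup Int.natAbs := Finset.le_sup (f := Int.natAbs) hi
  rw [hy i (by rw [Int.abs_eq_natAbs]; exact_mod_cast this)]
  exact (hu i hi).2

theorem mem_nhds_of_window {x : ℤ → A} (N : ℕ) :
    {y : ℤ → A | ∀ i : ℤ, |i| ≤ N → y i = x i} ∈ nhds x := by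
  have : {y : ℤ → A | ∀ i : ℤ, |i| ≤ N → y i = x i} =
      ⋂ i ∈ Set.Icc (-(N : ℤ)) N, {y : ℤ → A | y i = x i} := by
    ext y
    simp [abs_le]
  rw [this, Filter.biInter_mem (Set.finite_Icc _ _)]
  intro i _
  exact (continuous_apply i).continuousAt.preimage_mem_nhds
    (t := {x i}) (by simp)

/-- Continuous maps on a subshift over a finite alphabet are sliding block maps. -/
theorem exists_radius [Finite A] {X : Set (ℤ → A)} (hX : IsClosed X) {f : X → A}
    (hf : Continuous f) :
    ∃ R : ℕ, ∀ x y : X, (∀ i : ℤ, |i| ≤ R → x.1 i = y.1 i) → f x = f y := by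
  have hloc : ∀ x : X, ∃ N : ℕ, ∀ y : X, (∀ i : ℤ, |i| ≤ N → y.1 i = x.1 i) → f y = f x := by
    intro x
    have h1 : f ⁻¹' {f x} ∈ nhds x := hf.continuousAt.preimage_mem_nhds (by simp)
    rw [nhds_subtype_eq_comap, Filter.mem_comap] at h1
    obtain ⟨U, hU, hUf⟩ := h1
    obtain ⟨N, hN⟩ := exists_window_of_mem_nhds hU
    exact ⟨N, fun y hy => hUf (hN _ hy)⟩
  choose N hN using hloc
  have : CompactSpace X := isCompact_iff_compactSpace.1 hX.isCompact
  obtain ⟨t, ht⟩ := isCompact_univ.elim_nhds_subcover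
    (fun x : X => {y : X | ∀ i : ℤ, |i| ≤ N x → y.1 i = x.1 i})
    (fun x _ => continuous_subtype_val.continuousAt.preimage_mem_nhds (mem_nhds_of_window (N x)))
  refine ⟨t.sup N, fun x y hxy => ?_⟩
  obtain ⟨z, hz, hxz⟩ := Set.mem_iUnion₂.1 (ht.2 (Set.mem_univ x))
  have hle : N z ≤ t.sup N := Finset.le_sup hz
  rw [hN z x hxz, hN z y fun i hi => ?_]
  rw [← hxz i hi, hxy i (hi.trans (by exact_mod_cast hle))]

end Topology

end SubshiftZ

/-- The action on bi-infinite configurations of the constant length substitution with columns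
`c 0, …, c (L - 1)`. -/
def inflateConfig {A : Type*} (L : ℕ) (c : ℤ → Equiv.Perm A) (x : ℤ → A) : ℤ → A :=
  fun i => c (i % L) (x (i / L))

section inflateConfig

open SubshiftZ

variable {A : Type*} {L : ℕ} {c : ℤ → Equiv.Perm A}

theorem inflateConfig_mul_add (x : ℤ → A) (j : ℤ) {k : ℤ} (h0 : 0 ≤ k) (hk : k < L) :
    inflateConfig L c x (L * j + k) = c k (x j) := by
  have h1 : (L * j + k) % (L : ℤ) = k := by
    rw [Int.mul_add_emod_self_left, Int.emod_eq_of_lt h0 hk]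
  have h2 : (L * j + k) / (L : ℤ) = j := by
    rw [Int.mul_add_ediv_left _ _ (by omega), Int.ediv_eq_zero_of_lt h0 hk, add_zero]
  simp only [inflateConfig, h1, h2]

theorem inflateConfig_mul (hL : 0 < L) (x : ℤ → A) (j : ℤ) :
    inflateConfig L c x (L * j) = c 0 (x j) := by
  simpa using inflateConfig_mul_add (c := c) x j le_rfl (by exact_mod_cast hL)

theorem inflateConfig_injective (hL : 0 < L) : Function.Injective (inflateConfig L c) := by
  intro x y h
  ext j
  have := congr_fun h (L * j)
  rw [inflateConfig_mul hL, inflateConfig_mul hL] at this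
  exact (c 0).injective this

theorem inflateConfig_shift (hL : 0 < L) (t : ℤ) (x : ℤ → A) :
    inflateConfig L c (shift t x) = shift (L * t) (inflateConfig L c x) := by
  ext i
  simp only [inflateConfig, shift_apply, Int.mul_add_emod_self_left]
  rw [Int.mul_add_ediv_left _ _ (by omega)]

theorem inflateConfig_iterate_shift (hL : 0 < L) (n : ℕ) (t : ℤ) (x : ℤ → A) :
    (inflateConfig L c)^[n] (shift t x) = shift (L ^ n * t) ((inflateConfig L c)^[n] x) := by
  induction n with
  | zero => simp
  | succ n ih =>
    rw [Function.iterate_succ_apply', Function.iterate_succ_apply', ih, inflateConfig_shift hL]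
    congr 1
    ring

theorem exists_inflateConfig_iterate_apply (n : ℕ) (i : ℤ) :
    ∃ e : Equiv.Perm A, ∀ x, (inflateConfig L c)^[n] x i = e (x (i / (L : ℤ) ^ n)) := by
  induction n generalizing i with
  | zero => exact ⟨1, fun x => by simp⟩
  | succ n ih =>
    obtain ⟨e, he⟩ := ih (i / L)
    refine ⟨c (i % L) * e, fun x => ?_⟩
    rw [Function.iterate_succ_apply']
    simp only [inflateConfig] at he ⊢
    rw [he, Int.ediv_ediv_of_nonneg (by positivity), ← pow_succ']
    rfl

theorem inflateConfig_iterate_apply_eq_iff (n : ℕ) (i : ℤ) (x y : ℤ → A) :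
    (inflateConfig L c)^[n] x i = (inflateConfig L c)^[n] y i ↔
      x (i / (L : ℤ) ^ n) = y (i / (L : ℤ) ^ n) := by
  obtain ⟨e, he⟩ := exists_inflateConfig_iterate_apply (L := L) (c := c) n i
  rw [he, he, e.injective.eq_iff]

theorem continuous_inflateConfig [TopologicalSpace A] [DiscreteTopology A] :
    Continuous (inflateConfig L c) :=
  continuous_pi fun i => (continuous_of_discreteTopology (f := c (i % L))).comp
    (continuous_apply (i / (L : ℤ)))

/-- An aperiodic subshift that is generated by the substitution with columns
`c 0, …, c (L - 1)`: it is minimal, and its points are the shifted images of its points. -/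
structure IsBijectiveSubstSystem [TopologicalSpace A] (L : ℕ) (c : ℤ → Equiv.Perm A)
    (X : Set (ℤ → A)) : Prop where
  one_lt : 1 < L
  isClosed : IsClosed X
  shift_mem : ∀ t : ℤ, ∀ x ∈ X, shift t x ∈ X
  inflate_mem : ∀ x ∈ X, inflateConfig L c x ∈ X
  exists_desubst : ∀ x ∈ X, ∃ r : ℤ, ∃ y ∈ X, x = shift r (inflateConfig L c y)
  mem_closure : ∀ x ∈ X, ∀ y ∈ X, y ∈ closure (Set.range fun t : ℤ => shift t x)
  aperiodic : ∀ x ∈ X, ∀ p : ℤ, shift p x = x → p = 0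
  exists_letter : X.Nonempty → ∀ a, ∃ x ∈ X, x 0 = a

/-- `x` is the shift by `r` of an `n`-fold inflated point of `X`. -/
def HasSeam (L : ℕ) (c : ℤ → Equiv.Perm A) (X : Set (ℤ → A)) (n : ℕ) (x : ℤ → A) (r : ℤ) :
    Prop :=
  ∃ y ∈ X, x = shift r ((inflateConfig L c)^[n] y)

namespace IsBijectiveSubstSystem

variable [TopologicalSpace A] {X : Set (ℤ → A)}
  (hX : IsBijectiveSubstSystem L c X)
include hX

theorem pos : 0 < L := by
  have := hX.one_lt
  omega

theorem iterate_mem (n : ℕ) {x : ℤ → A} (hx : x ∈ X) : (inflateConfig L c)^[n] x ∈ X := by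
  induction n with
  | zero => exact hx
  | succ n ih =>
    rw [Function.iterate_succ_apply']
    exact hX.inflate_mem _ ih

end IsBijectiveSubstSystem
end inflateConfig

/-- Desubstitution can be iterated. -/
theorem exists_hasSeam {A : Type*} {L : ℕ} {c : ℤ → Equiv.Perm A} {X : Set (ℤ → A)} (hL : 0 < L)
    (h : ∀ x ∈ X, ∃ r : ℤ, ∃ y ∈ X, x = shift r (inflateConfig L c y)) (n : ℕ) {x : ℤ → A}
    (hx : x ∈ X) : ∃ r, HasSeam L c X n x r := by
  induction n with
  | zero => exact ⟨0, x, hx, (SubshiftZ.shift_zero x).symm⟩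
  | succ n ih =>
    obtain ⟨r, y, hy, rfl⟩ := ih
    obtain ⟨s, z, hz, rfl⟩ := h y hy
    refine ⟨r + L ^ n * s, z, hz, ?_⟩
    rw [inflateConfig_iterate_shift hL, SubshiftZ.shift_shift, Function.iterate_succ_apply]

namespace IsBijectiveSubstSystem

open SubshiftZ

variable {A : Type*} {L : ℕ} {c : ℤ → Equiv.Perm A} [TopologicalSpace A] {X : Set (ℤ → A)}
  (hX : IsBijectiveSubstSystem L c X)
include hX

theorem succ_ne [Finite A] {x : ℤ → A} (hx : x ∈ X) (f : A → A) :
    ¬ ∀ j, x (j + 1) = f (x j) := by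
  intro h
  obtain ⟨p, hp, hpx⟩ := exists_period_of_succ_eq h
  exact hp (hX.aperiodic x hx p hpx)

/-- Some letter has two different successors. -/
theorem exists_branch [Finite A] (hne : X.Nonempty) :
    ∃ x ∈ X, ∃ y ∈ X, x (-1) = y (-1) ∧ x 0 ≠ y 0 := by
  by_contra! hc
  obtain ⟨z, hz⟩ := hne
  have h : ∀ a : A, ∃ b, ∀ x ∈ X, x (-1) = a → x 0 = b := by
    intro a
    by_cases ha : ∃ x ∈ X, x (-1) = a
    · obtain ⟨x, hx, hxa⟩ := ha
      exact ⟨x 0, fun y hy hya => hc y hy x hx (hya.trans hxa.symm)⟩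
    · exact ⟨a, fun y hy hya => absurd ⟨y, hy, hya⟩ ha⟩
  choose f hf using h
  refine hX.succ_ne hz f fun j => ?_
  have := hf (z j) (shift (j + 1) z) (hX.shift_mem _ _ hz) (by simp [shift_apply])
  simpa [shift_apply] using this

/-- Recognizability. -/
theorem dvd_of_inflate_eq [Finite A] {x y : ℤ → A} (hy : y ∈ X) {k : ℤ}
    (h : inflateConfig L c x = shift k (inflateConfig L c y)) : (L : ℤ) ∣ k := by
  have hL : (0 : ℤ) < L := by exact_mod_cast hX.pos
  by_contra hk
  set s := k % L with hs
  set q := k / L with hq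
  have hkq : k = L * q + s := (Int.mul_ediv_add_emod k L).symm
  have hs0 : 0 < s := lt_of_le_of_ne (Int.emod_nonneg _ hL.ne')
    fun h => hk (Int.dvd_of_emod_eq_zero h.symm)
  have hsL : s < L := Int.emod_lt_of_pos _ hL
  have h1 : ∀ j, c 0 (x j) = c s (y (q + j)) := by
    intro j
    rw [← inflateConfig_mul hX.pos, h, shift_apply,
      ← inflateConfig_mul_add (L := L) y (q + j) hs0.le hsL, hkq]
    congr 1
    ring
  have h2 : ∀ j, c (L - s) (x j) = c 0 (y (q + j + 1)) := by
    intro j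
    rw [← inflateConfig_mul_add (L := L) x j (by omega) (by omega), h, shift_apply,
      ← inflateConfig_mul hX.pos, hkq]
    congr 1
    ring
  refine hX.succ_ne hy (fun a => (c 0).symm (c (L - s) ((c 0).symm (c s a)))) fun j => ?_
  have e1 := h1 (j - q)
  have e2 := h2 (j - q)
  rw [add_sub_cancel] at e1 e2
  rw [← e1, Equiv.symm_apply_apply, e2, Equiv.symm_apply_apply]

theorem pow_dvd_of_iterate_eq [Finite A] (n : ℕ) {x y : ℤ → A} (hy : y ∈ X) {k : ℤ}
    (h : (inflateConfig L c)^[n] x = shift k ((inflateConfig L c)^[n] y)) :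
    (L : ℤ) ^ n ∣ k := by
  induction n generalizing k with
  | zero => simp
  | succ n ih =>
    rw [Function.iterate_succ_apply', Function.iterate_succ_apply'] at h
    obtain ⟨q, rfl⟩ := hX.dvd_of_inflate_eq (hX.iterate_mem n hy) h
    rw [← inflateConfig_shift hX.pos] at h
    rw [pow_succ']
    exact mul_dvd_mul_left _ (ih (inflateConfig_injective hX.pos h))

omit [TopologicalSpace A] hX in
theorem seam_iterate (n : ℕ) {x : ℤ → A} (hx : x ∈ X) :
    HasSeam L c X n ((inflateConfig L c)^[n] x) 0 := ⟨x, hx, (shift_zero _).symm⟩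

theorem seam_dvd_sub [Finite A] {n : ℕ} {x : ℤ → A} {r s : ℤ} (hr : HasSeam L c X n x r)
    (hs : HasSeam L c X n x s) : (L : ℤ) ^ n ∣ r - s := by
  obtain ⟨y, hy, hxy⟩ := hr
  obtain ⟨z, hz, rfl⟩ := hs
  refine hX.pow_dvd_of_iterate_eq n (x := z) hy ?_
  rw [sub_eq_neg_add, ← shift_shift, ← hxy, shift_shift, neg_add_cancel, shift_zero]

theorem seam_of_dvd {n : ℕ} {x : ℤ → A} {r s : ℤ} (hr : HasSeam L c X n x r)
    (h : (L : ℤ) ^ n ∣ r - s) : HasSeam L c X n x s := by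
  obtain ⟨y, hy, rfl⟩ := hr
  obtain ⟨q, hq⟩ := h
  refine ⟨shift q y, hX.shift_mem _ _ hy, ?_⟩
  rw [inflateConfig_iterate_shift hX.pos, shift_shift, ← hq]
  congr 1
  ring

theorem seam_mod {n : ℕ} {x : ℤ → A} {r : ℤ} (hr : HasSeam L c X n x r) :
    HasSeam L c X n x (r % (L : ℤ) ^ n) :=
  hX.seam_of_dvd hr (Int.dvd_self_sub_emod)

omit [TopologicalSpace A] hX in
theorem seam_shift {n : ℕ} {x : ℤ → A} {r : ℤ} (hr : HasSeam L c X n x r) (t : ℤ) :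
    HasSeam L c X n (shift t x) (r + t) := by
  obtain ⟨y, hy, rfl⟩ := hr
  exact ⟨y, hy, by rw [shift_shift, add_comm]⟩

theorem seam_anti {m n : ℕ} (hmn : m ≤ n) {x : ℤ → A} {r : ℤ} (hr : HasSeam L c X n x r) :
    HasSeam L c X m x r := by
  obtain ⟨k, rfl⟩ := Nat.exists_eq_add_of_le hmn
  obtain ⟨y, hy, rfl⟩ := hr
  exact ⟨_, hX.iterate_mem k hy, by rw [← Function.iterate_add_apply]⟩

/-- The shift by `t` as a self-map of the subshift. -/
def shiftMap (t : ℤ) (x : X) : X := ⟨shift t x.1, hX.shift_mem t _ x.2⟩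

/-- The substitution as a self-map of the subshift. -/
def inflateMap (x : X) : X := ⟨inflateConfig L c x.1, hX.inflate_mem _ x.2⟩

theorem coe_inflateMap_iterate (n : ℕ) (x : X) :
    (hX.inflateMap^[n] x).1 = (inflateConfig L c)^[n] x.1 := by
  induction n with
  | zero => rfl
  | succ n ih =>
    rw [Function.iterate_succ_apply', Function.iterate_succ_apply', ← ih]
    rfl

theorem inflateMap_injective : Function.Injective hX.inflateMap := fun _ _ h =>
  Subtype.ext (inflateConfig_injective hX.pos (congr_arg Subtype.val h))

theorem inflateMap_shiftMap (t : ℤ) (x : X) :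
    hX.inflateMap (hX.shiftMap t x) = hX.shiftMap (L * t) (hX.inflateMap x) :=
  Subtype.ext (inflateConfig_shift hX.pos t x.1)

theorem exists_eq_shiftMap_inflateMap (x : X) :
    ∃ r y, x = hX.shiftMap r (hX.inflateMap y) := by
  obtain ⟨r, y, hy, h⟩ := hX.exists_desubst x.1 x.2
  exact ⟨r, ⟨y, hy⟩, Subtype.ext h⟩

/-- A self-map of the subshift that conjugates the shift to its inverse. -/
def IsReversing (H : X → X) : Prop :=
  ∀ t x, H (hX.shiftMap t x) = hX.shiftMap (-t) (H x)

variable [DiscreteTopology A] [Finite A]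

theorem isClosed_seam (n : ℕ) (r : ℤ) : IsClosed {x | HasSeam L c X n x r} := by
  have : {x | HasSeam L c X n x r} =
      (fun y => shift r ((inflateConfig L c)^[n] y)) '' X := by
    ext x
    simp only [HasSeam, Set.mem_ofPred_eq, Set.mem_image, eq_comm]
  rw [this]
  exact (hX.isClosed.isCompact.image
    ((continuous_shift r).comp (continuous_inflateConfig.iterate n))).isClosed

/-- A reversing continuous map acts on the seams of level `n` by a reflection. -/
theorem exists_seam_reflection {H : X → X} (hHc : Continuous H) (hH : hX.IsReversing H)
    (x₀ : X) (n : ℕ) {r₀ s₀ : ℤ} (hr₀ : HasSeam L c X n x₀.1 r₀)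
    (hs₀ : HasSeam L c X n (H x₀).1 s₀) (x : X) :
    ∃ r, HasSeam L c X n x.1 r ∧ HasSeam L c X n (H x).1 (r₀ + s₀ - r) := by
  have hLn : (0 : ℤ) < (L : ℤ) ^ n := pow_pos (by exact_mod_cast hX.pos) n
  let Y : Set X :=
    ⋃ r ∈ Set.Ico (0 : ℤ) ((L : ℤ) ^ n), {x : X | HasSeam L c X n x.1 r} ∩
      {x : X | HasSeam L c X n (H x).1 (r₀ + s₀ - r)}
  have hY : IsClosed Y := (Set.finite_Ico _ _).isClosed_biUnion fun r _ =>
    ((hX.isClosed_seam n r).preimage continuous_subtype_val).inter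
      ((hX.isClosed_seam n _).preimage (continuous_subtype_val.comp hHc))
  have hYi : IsClosed (Subtype.val '' Y) :=
    (hX.isClosed.isClosedEmbedding_subtypeVal.isClosed_iff_image_isClosed).1 hY
  have horb : Set.range (fun t : ℤ => shift t x₀.1) ⊆ Subtype.val '' Y := by
    rintro _ ⟨t, rfl⟩
    refine ⟨hX.shiftMap t x₀, ?_, rfl⟩
    refine Set.mem_iUnion₂.2 ⟨(r₀ + t) % (L : ℤ) ^ n,
      ⟨Int.emod_nonneg _ hLn.ne', Int.emod_lt_of_pos _ hLn⟩, hX.seam_mod (seam_shift hr₀ t), ?_⟩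
    rw [Set.mem_ofPred_eq, hH]
    refine hX.seam_of_dvd (seam_shift hs₀ (-t)) ?_
    obtain ⟨q, hq⟩ := Int.dvd_self_sub_emod (x := r₀ + t) (m := (L : ℤ) ^ n)
    exact ⟨-q, by rw [mul_neg, ← hq]; ring⟩
  obtain ⟨y, hy, hyx⟩ := closure_minimal horb hYi (hX.mem_closure _ x₀.2 _ x.2)
  obtain rfl : y = x := Subtype.ext hyx
  obtain ⟨r, -, h1, h2⟩ := Set.mem_iUnion₂.1 hy
  exact ⟨r, h1, h2⟩

end IsBijectiveSubstSystem

/-- Two integers in different blocks of length `P` are separated by a multiple of `P`. -/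
theorem Int.exists_mul_between {P a b : ℤ} (hP : 0 < P) (h : a / P ≠ b / P) :
    ∃ q, min a b ≤ P * q ∧ P * q ≤ max a b := by
  have ha1 := Int.mul_ediv_self_le (x := a) hP.ne'
  have hb1 := Int.mul_ediv_self_le (x := b) hP.ne'
  have ha2 := Int.lt_mul_ediv_self_add (x := a) hP
  have hb2 := Int.lt_mul_ediv_self_add (x := b) hP
  rcases lt_or_gt_of_ne h with h | h
  · refine ⟨b / P, (min_le_left _ _).trans ?_, hb1.trans (le_max_right _ _)⟩
    nlinarith
  · refine ⟨a / P, (min_le_right _ _).trans ?_, ha1.trans (le_max_left _ _)⟩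
    nlinarith

namespace IsBijectiveSubstSystem

open SubshiftZ

variable {A : Type*} {L : ℕ} {c : ℤ → Equiv.Perm A} [TopologicalSpace A] {X : Set (ℤ → A)}
  (hX : IsBijectiveSubstSystem L c X)
include hX

section Radius

variable [DiscreteTopology A] [Finite A]

omit hX in
theorem exists_radius_zero (hXc : IsClosed X) {H : X → X} (hHc : Continuous H) :
    ∃ R : ℕ, ∀ x y : X, (∀ i : ℤ, |i| ≤ R → x.1 i = y.1 i) → (H x).1 0 = (H y).1 0 :=
  exists_radius hXc (f := fun x => (H x).1 0)
    ((continuous_apply 0).comp (continuous_subtype_val.comp hHc))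

theorem exists_radius_of_isReversing {H : X → X} (hHc : Continuous H) (hH : hX.IsReversing H) :
    ∃ R : ℕ, ∀ (x y : X) (i : ℤ), (∀ j : ℤ, |j| ≤ R → x.1 (j - i) = y.1 (j - i)) →
      (H x).1 i = (H y).1 i := by
  obtain ⟨R, hR⟩ := exists_radius_zero hX.isClosed hHc
  refine ⟨R, fun x y i h => ?_⟩
  have key : ∀ z : X, (H z).1 i = (H (hX.shiftMap (-i) z)).1 0 := by
    intro z
    rw [hH]
    simp [shiftMap, shift_apply]
  rw [key, key]
  refine hR _ _ fun j hj => ?_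
  have := h j hj
  simpa only [shiftMap, shift_apply, sub_eq_neg_add] using this

/-- Up to a fixed shift, a reversing homeomorphism preserves the images of all powers of the
substitution. -/
theorem exists_seam_forall (H : X ≃ₜ X) (hH : hX.IsReversing H) (hne : X.Nonempty) :
    ∃ d : ℤ, ∀ (n : ℕ) (x : X), HasSeam L c X n (H (hX.inflateMap^[n] x)).1 d := by
  obtain ⟨R, hR⟩ := hX.exists_radius_of_isReversing H.continuous hH
  obtain ⟨R', hR'⟩ := exists_radius_zero hX.isClosed H.symm.continuous
  obtain ⟨x, hx, y, hy, hxy, hxy'⟩ := hX.exists_branch hne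
  have hQ : ∃ d ∈ Set.Icc (-(R + R' + 1 : ℤ)) (R + R' + 1), ∀ n : ℕ, ∀ z : X,
      ∃ r, HasSeam L c X n z.1 r ∧ HasSeam L c X n (H z).1 (d - r) := by
    refine (Set.finite_Icc _ _).exists_forall_of_antitone ?_ ?_
    · intro m n d hmn h z
      obtain ⟨r, h1, h2⟩ := h z
      exact ⟨r, hX.seam_anti hmn h1, hX.seam_anti hmn h2⟩
    intro n
    obtain ⟨m, hnm, hm⟩ : ∃ m, n ≤ m ∧ (2 * R + 2 : ℤ) ≤ (L : ℤ) ^ m := by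
      refine ⟨n + (2 * R + 2), by omega, ?_⟩
      have := Nat.lt_pow_self (n := n + (2 * R + 2)) hX.one_lt
      have h2 : 2 * R + 2 ≤ L ^ (n + (2 * R + 2)) := by omega
      exact_mod_cast h2
    have hP : (0 : ℤ) < (L : ℤ) ^ m := by omega
    set P := (L : ℤ) ^ m with hPdef
    set u : X := hX.inflateMap^[m] ⟨x, hx⟩ with hu
    set v : X := hX.inflateMap^[m] ⟨y, hy⟩ with hv
    have huv : ∀ i : ℤ, u.1 i = v.1 i ↔ x (i / P) = y (i / P) := by
      intro i
      rw [hu, hv, coe_inflateMap_iterate, coe_inflateMap_iterate,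
        inflateConfig_iterate_apply_eq_iff]
    have hsu : HasSeam L c X m u.1 0 := by
      rw [hu, coe_inflateMap_iterate]
      exact seam_iterate m hx
    have hsv : HasSeam L c X m v.1 0 := by
      rw [hv, coe_inflateMap_iterate]
      exact seam_iterate m hy
    obtain ⟨s, hs⟩ := exists_hasSeam hX.pos hX.exists_desubst m (H u).2
    have hrefl := hX.exists_seam_reflection H.continuous hH u m hsu hs
    rw [zero_add] at hrefl
    have hsHv : HasSeam L c X m (H v).1 s := by
      obtain ⟨r, h1, h2⟩ := hrefl v
      refine hX.seam_of_dvd h2 ?_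
      have := hX.seam_dvd_sub hsv h1
      convert this using 1
      ring
    have hagree : (H u).1 (R + 1) = (H v).1 (R + 1) := by
      refine hR _ _ _ fun j hj => (huv _).2 ?_
      have : (j - (R + 1)) / P = -1 := by
        rw [abs_le] at hj
        rw [Int.ediv_eq_iff_of_pos hP]
        constructor <;> linarith
      rw [this, hxy]
    have hdiff : ∃ i : ℤ, |i| ≤ R' ∧ (H u).1 i ≠ (H v).1 i := by
      by_contra! hc
      have := hR' _ _ hc
      rw [H.symm_apply_apply, H.symm_apply_apply, huv, Int.zero_ediv] at this
      exact hxy' this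
    obtain ⟨i, hi, hiuv⟩ := hdiff
    obtain ⟨u', -, hu'⟩ := hs
    obtain ⟨v', -, hv'⟩ := hsHv
    rw [hu', hv', shift_apply, shift_apply, inflateConfig_iterate_apply_eq_iff] at hagree
    rw [hu', hv', shift_apply, shift_apply, Ne, inflateConfig_iterate_apply_eq_iff] at hiuv
    have hne : (s + (R + 1)) / P ≠ (s + i) / P := by
      intro h
      rw [← h] at hiuv
      exact hiuv hagree
    obtain ⟨q, hq1, hq2⟩ := Int.exists_mul_between hP hne
    rw [abs_le] at hi
    refine ⟨s - P * q, ⟨?_, ?_⟩, fun z => ?_⟩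
    · rcases le_max_iff.1 hq2 with h | h <;> omega
    · rcases min_le_iff.1 hq1 with h | h <;> omega
    · obtain ⟨r, h1, h2⟩ := hrefl z
      exact ⟨r, hX.seam_anti hnm h1,
        hX.seam_anti hnm (hX.seam_of_dvd h2 ⟨q, by ring⟩)⟩
  obtain ⟨d, -, hd⟩ := hQ
  refine ⟨d, fun n x => ?_⟩
  obtain ⟨r, h1, h2⟩ := hd n (hX.inflateMap^[n] x)
  rw [coe_inflateMap_iterate] at h1
  refine hX.seam_of_dvd h2 ?_
  have := hX.seam_dvd_sub (seam_iterate n x.2) h1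
  convert this using 1
  ring

end Radius

/-- The reversing maps that preserve the images of all powers of the substitution. -/
abbrev SeamReversor : Type _ :=
  {G : X → X // hX.IsReversing G ∧
    ∀ (n : ℕ) (x : X), ∃ y, G (hX.inflateMap^[n] x) = hX.inflateMap^[n] y}

end IsBijectiveSubstSystem

namespace IsBijectiveSubstSystem

open SubshiftZ

variable {A : Type*} {L : ℕ} {c : ℤ → Equiv.Perm A} [TopologicalSpace A] {X : Set (ℤ → A)}
  {hX : IsBijectiveSubstSystem L c X}

namespace SeamReversor

theorem exists_deflate (G : hX.SeamReversor) (x : X) :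
    ∃ y, G.1 (hX.inflateMap x) = hX.inflateMap y :=
  G.2.2 1 x

/-- Conjugation by the substitution. -/
noncomputable def deflate (G : hX.SeamReversor) : hX.SeamReversor := by
  have hG : ∀ x, hX.inflateMap (G.exists_deflate x).choose = G.1 (hX.inflateMap x) :=
    fun x => (G.exists_deflate x).choose_spec.symm
  refine ⟨fun x => (G.exists_deflate x).choose, fun t x => ?_, fun n x => ?_⟩
  · apply hX.inflateMap_injective
    rw [hG, hX.inflateMap_shiftMap, G.2.1, hX.inflateMap_shiftMap, hG, mul_neg]
  · obtain ⟨y, hy⟩ := G.2.2 (n + 1) x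
    refine ⟨y, hX.inflateMap_injective ?_⟩
    rw [hG, ← Function.iterate_succ_apply' hX.inflateMap, hy, Function.iterate_succ_apply']

theorem inflateMap_deflate (G : hX.SeamReversor) (x : X) :
    hX.inflateMap (G.deflate.1 x) = G.1 (hX.inflateMap x) :=
  (G.exists_deflate x).choose_spec.symm

theorem inflateMap_iterate_deflate (n : ℕ) (G : hX.SeamReversor) (x : X) :
    hX.inflateMap^[n] ((deflate^[n] G).1 x) = G.1 (hX.inflateMap^[n] x) := by
  induction n generalizing G x with
  | zero => rfl
  | succ n ih =>
    rw [Function.iterate_succ_apply, Function.iterate_succ_apply', inflateMap_deflate, ih,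
      Function.iterate_succ_apply]

theorem deflate_injective : Function.Injective (deflate (hX := hX)) := by
  intro G G' h
  refine Subtype.ext (funext fun x => ?_)
  obtain ⟨r, y, rfl⟩ := hX.exists_eq_shiftMap_inflateMap x
  rw [G.2.1, G'.2.1, ← inflateMap_deflate, ← inflateMap_deflate, h]

/-- The mirroring maps composed with a map of the letters. -/
def IsLetterwise (G : hX.SeamReversor) : Prop :=
  ∃ p : A → A, ∀ (x : X) (i : ℤ), (G.1 x).1 i = p (x.1 (-1 - i))

theorem finite_isLetterwise [Finite A] : {G : hX.SeamReversor | G.IsLetterwise}.Finite := by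
  have h : ∀ p : A → A,
      {G : hX.SeamReversor | ∀ x i, (G.1 x).1 i = p (x.1 (-1 - i))}.Subsingleton := by
    intro p G hG G' hG'
    refine Subtype.ext (funext fun x => Subtype.ext (funext fun i => ?_))
    rw [hG, hG']
  refine (Set.finite_iUnion fun p => (h p).finite).subset fun G hG => ?_
  exact Set.mem_iUnion.2 hG

theorem IsLetterwise.deflate {G : hX.SeamReversor} (hG : G.IsLetterwise) :
    G.deflate.IsLetterwise := by
  obtain ⟨p, hp⟩ := hG
  refine ⟨fun a => (c 0).symm (p (c (L - 1) a)), fun x i => ?_⟩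
  have h1 := congr_fun (congr_arg Subtype.val (inflateMap_deflate G x)) (L * i)
  have hL := hX.pos
  rw [hp] at h1
  simp only [inflateMap] at h1
  rw [inflateConfig_mul hX.pos, show -1 - (L : ℤ) * i = L * (-1 - i) + (L - 1) by ring,
    inflateConfig_mul_add _ _ (by omega) (by omega)] at h1
  change _ = (c 0).symm (p (c (L - 1) _))
  rw [← h1, Equiv.symm_apply_apply]

variable [DiscreteTopology A] [Finite A]

theorem exists_isLetterwise_iterate (G : hX.SeamReversor) (hGc : Continuous G.1) :
    ∃ n, (SeamReversor.deflate^[n] G).IsLetterwise := by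
  obtain ⟨R, hR⟩ := hX.exists_radius_of_isReversing hGc G.2.1
  have hm : (2 * R + 2 : ℤ) ≤ (L : ℤ) ^ (2 * R + 2) := by
    have := Nat.lt_pow_self (n := 2 * R + 2) hX.one_lt
    exact_mod_cast this.le
  refine ⟨2 * R + 2, ?_⟩
  set n := 2 * R + 2
  set F := SeamReversor.deflate^[n] G with hF
  have hP : (0 : ℤ) < (L : ℤ) ^ n := by omega
  set P := (L : ℤ) ^ n with hPdef
  have key : ∀ x y : X, x.1 (-1) = y.1 (-1) → (F.1 x).1 0 = (F.1 y).1 0 := by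
    intro x y hxy
    have h1 : (G.1 (hX.inflateMap^[n] x)).1 (R + 1) = (G.1 (hX.inflateMap^[n] y)).1 (R + 1) := by
      refine hR _ _ _ fun j hj => ?_
      rw [coe_inflateMap_iterate, coe_inflateMap_iterate, inflateConfig_iterate_apply_eq_iff]
      have : (j - (R + 1)) / P = -1 := by
        rw [abs_le] at hj
        rw [Int.ediv_eq_iff_of_pos hP]
        constructor <;> linarith
      rw [this, hxy]
    rw [← inflateMap_iterate_deflate, ← inflateMap_iterate_deflate, coe_inflateMap_iterate,
      coe_inflateMap_iterate, inflateConfig_iterate_apply_eq_iff,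
      Int.ediv_eq_zero_of_lt (by omega) (by omega)] at h1
    exact h1
  have h : ∀ a : A, ∃ b, ∀ x : X, x.1 (-1) = a → (F.1 x).1 0 = b := by
    intro a
    by_cases ha : ∃ x : X, x.1 (-1) = a
    · obtain ⟨x, hx⟩ := ha
      exact ⟨_, fun y hy => key y x (hy.trans hx.symm)⟩
    · exact ⟨a, fun y hy => absurd ⟨y, hy⟩ ha⟩
  choose p hp using h
  refine ⟨p, fun x i => ?_⟩
  have h1 := hp _ (hX.shiftMap (-i) x) rfl
  rw [F.2.1] at h1
  simp only [shiftMap, shift_apply, neg_neg, add_zero] at h1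
  rw [h1, neg_add_eq_sub]

theorem isLetterwise (G : hX.SeamReversor) (hGc : Continuous G.1) : G.IsLetterwise := by
  obtain ⟨n, hn⟩ := G.exists_isLetterwise_iterate hGc
  exact deflate_injective.mem_of_iterate_mem finite_isLetterwise
    (fun _ h => IsLetterwise.deflate h) hn

end SeamReversor

variable [DiscreteTopology A] [Finite A]

variable (hX) in
/-- A reversing homeomorphism is a mirroring map composed with a permutation of the letters. -/
theorem exists_perm_forall_apply (H : X ≃ₜ X) (hH : hX.IsReversing H) (hne : X.Nonempty) :
    ∃ (π : Equiv.Perm A) (d : ℤ), ∀ (x : X) (i : ℤ), (H x).1 i = π (x.1 (d - i)) := by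
  obtain ⟨d, hd⟩ := hX.exists_seam_forall H hH hne
  have hrev : hX.IsReversing fun x => hX.shiftMap (-d) (H x) := by
    intro t x
    refine Subtype.ext ?_
    change shift (-d) (H (hX.shiftMap t x)).1 = shift (-t) (shift (-d) (H x).1)
    rw [hH, shift_shift]
    change shift (-d) (shift (-t) (H x).1) = _
    rw [shift_shift, add_comm]
  let G : hX.SeamReversor := ⟨_, hrev, fun n x => by
    obtain ⟨y, hy, h⟩ := hd n x
    refine ⟨⟨y, hy⟩, Subtype.ext ?_⟩
    rw [coe_inflateMap_iterate]
    simp only [shiftMap, h, shift_shift, neg_add_cancel, shift_zero]⟩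
  have hGc : Continuous G.1 :=
    ((continuous_shift (-d)).comp (continuous_subtype_val.comp H.continuous)).subtype_mk _
  obtain ⟨p, hp⟩ := G.isLetterwise hGc
  have hHp : ∀ (x : X) (i : ℤ), (H x).1 i = p (x.1 (-1 - d - i)) := by
    intro x i
    have := hp x (d + i)
    simp only [G, shiftMap, shift_apply, neg_add_cancel_left] at this
    rw [this, sub_add_eq_sub_sub]
  have hsurj : Function.Surjective p := by
    intro a
    obtain ⟨x, hx, hxa⟩ := hX.exists_letter hne a
    refine ⟨(H.symm ⟨x, hx⟩).1 (-1 - d - 0), ?_⟩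
    rw [← hHp, H.apply_symm_apply]
    exact hxa
  exact ⟨Equiv.ofBijective p (Finite.injective_iff_bijective.1
    (Finite.injective_iff_surjective.2 hsurj)), -1 - d, hHp⟩

end IsBijectiveSubstSystem

namespace ConstLengthSubst

variable {A : Type*} {L : ℕ} (ρ : ConstLengthSubst A L)

theorem length_inflate (w : List A) : (ρ.inflate w).length = L * w.length := by
  induction w with
  | nil => simp [inflate]
  | cons a w ih =>
    simp only [inflate, List.flatMap_cons, List.length_append, List.length_ofFn,
      List.length_cons] at ih ⊢
    rw [ih]
    ring

theorem getElem?_inflate (hL : 0 < L) (w : List A) (i : ℕ) :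
    (ρ.inflate w)[i]? = (w[i / L]?).map fun a => ρ a ⟨i % L, Nat.mod_lt i hL⟩ := by
  induction w generalizing i with
  | nil => simp [inflate]
  | cons a w ih =>
    have hcons : ρ.inflate (a :: w) = List.ofFn (ρ a) ++ ρ.inflate w := by simp [inflate]
    rw [hcons]
    by_cases hi : i < L
    · rw [List.getElem?_append_left (by simpa using hi)]
      simp [Nat.div_eq_of_lt hi, Nat.mod_eq_of_lt hi, hi]
    · push Not at hi
      obtain ⟨j, rfl⟩ := Nat.exists_eq_add_of_le hi
      rw [List.getElem?_append_right (by simp)]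
      simp [ih, Nat.add_div_left _ hL]

theorem iter_succ (k : ℕ) (a : A) : ρ.iter (k + 1) a = ρ.inflate (ρ.iter k a) :=
  Function.iterate_succ_apply' _ _ _

theorem inflate_infix {u v : List A} (h : u <:+: v) : ρ.inflate u <:+: ρ.inflate v := by
  obtain ⟨s, t, rfl⟩ := h
  exact ⟨ρ.inflate s, ρ.inflate t, by simp [inflate]⟩

theorem iter_infix_iter_add {a b : A} {m : ℕ} (h : a ∈ ρ.iter m b) (k : ℕ) :
    ρ.iter k a <:+: ρ.iter (m + k) b := by
  induction k with
  | zero => exact (List.singleton_infix_iff _ _).2 h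
  | succ k ih =>
    rw [iter_succ, ← add_assoc, iter_succ]
    exact ρ.inflate_infix ih

theorem mem_language_of_infix_iter {ρ : ConstLengthSubst A L} (hprim : ρ.IsPrimitive) {w : List A}
    {k : ℕ} {a : A} (h : w <:+: ρ.iter k a) : w ∈ ρ.language := by
  obtain ⟨m, hm, hprim⟩ := hprim
  exact ⟨m + k, by omega, a, h.trans (ρ.iter_infix_iter_add (hprim a a) k)⟩

theorem length_iter (k : ℕ) (a : A) : (ρ.iter k a).length = L ^ k := by
  induction k with
  | zero => rfl
  | succ k ih => rw [iter_succ, length_inflate, ih, pow_succ']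

theorem wordAt_infix_iff {x : ℤ → A} {n : ℤ} {m : ℕ} {v : List A} :
    wordAt x n m <:+: v ↔ ∃ s : ℕ, ∀ i < m, v[s + i]? = some (x (n + i)) := by
  rw [List.infix_iff_getElem?]
  constructor
  · rintro ⟨s, -, h⟩
    refine ⟨s, fun i hi => ?_⟩
    have := h i (by simpa [wordAt] using hi)
    rw [add_comm, this]
    simp [wordAt]
  · rintro ⟨s, h⟩
    rcases Nat.eq_zero_or_pos m with rfl | hm
    · exact ⟨0, by simp [wordAt], fun i hi => by simp [wordAt] at hi⟩
    · have hlen := (List.getElem?_eq_some_iff.1 (h (m - 1) (by omega))).1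
      refine ⟨s, by simp only [wordAt, List.length_ofFn]; omega, fun i hi => ?_⟩
      rw [add_comm, h i (by simpa [wordAt] using hi)]
      simp [wordAt]

/-- The columns of a bijective substitution as permutations, indexed periodically. -/
noncomputable def columnPerm {ρ : ConstLengthSubst A L} (hL : 0 < L) (hbij : ρ.IsBijective)
    (i : ℤ) : Equiv.Perm A :=
  Equiv.ofBijective _ (hbij ⟨(i % L).toNat, by
    have := Int.emod_lt_of_pos i (b := L) (by omega)
    omega⟩)

variable {ρ} (hL : 0 < L) (hbij : ρ.IsBijective)

theorem columnPerm_emod (n : ℕ) (a : A) :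
    columnPerm hL hbij ((n : ℤ) % L) a = ρ a ⟨n % L, Nat.mod_lt n hL⟩ := by
  simp only [columnPerm, column, Equiv.ofBijective_apply, Int.emod_emod]
  congr 1

theorem getElem?_inflate_eq_some {w : List A} {i : ℕ} {a : A} :
    (ρ.inflate w)[i]? = some a ↔
      ∃ b, w[i / L]? = some b ∧ columnPerm hL hbij ((i : ℤ) % L) b = a := by
  simp only [ρ.getElem?_inflate hL, Option.map_eq_some_iff, columnPerm_emod]

theorem getElem?_iter (n : ℕ) (x : ℤ → A) {i : ℕ} (hi : i < L ^ n) :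
    (ρ.iter n (x 0))[i]? = some ((inflateConfig L (columnPerm hL hbij))^[n] x i) := by
  induction n generalizing i with
  | zero =>
    obtain rfl : i = 0 := by simpa using hi
    rfl
  | succ n ih =>
    rw [iter_succ, getElem?_inflate_eq_some hL hbij]
    refine ⟨_, ih (Nat.div_lt_of_lt_mul (by rwa [← pow_succ'])), ?_⟩
    rw [Function.iterate_succ_apply']
    simp [inflateConfig]

section Hull

variable [TopologicalSpace A] [DiscreteTopology A]

theorem inflateConfig_mem_hull {x : ℤ → A} (hx : x ∈ ρ.hull.carrier) :
    inflateConfig L (columnPerm hL hbij) x ∈ ρ.hull.carrier := by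
  intro n m
  obtain ⟨k, hk, a, h⟩ := hx (n / L) (m + 1)
  obtain ⟨s, hs⟩ := wordAt_infix_iff.1 h
  refine ⟨k + 1, by omega, a, wordAt_infix_iff.2 ⟨L * s + (n % L).toNat, fun i hi => ?_⟩⟩
  have hr0 : 0 ≤ n % L := Int.emod_nonneg _ (by omega)
  have hrL : n % L < L := Int.emod_lt_of_pos _ (by omega)
  have hn := Int.mul_ediv_add_emod n L
  obtain ⟨r, hr⟩ := Int.eq_ofNat_of_zero_le hr0
  rw [hr] at hn hrL ⊢
  rw [Int.toNat_natCast, iter_succ, getElem?_inflate_eq_some hL hbij]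
  have hlt : (r + i) / L < m + 1 := by
    refine Nat.div_lt_of_lt_mul ?_
    have h1 : r < L := by exact_mod_cast hrL
    nlinarith
  have hni : n + i = L * (n / L) + (r + i : ℕ) := by
    push_cast
    linarith
  refine ⟨x (n / L + ((r + i) / L : ℕ)), ?_, ?_⟩
  · rw [← hs _ hlt, add_assoc, Nat.mul_add_div hL]
  · simp only [inflateConfig]
    rw [hni, Int.mul_add_emod_self_left, Int.mul_add_ediv_left _ _ (by omega), add_assoc]
    push_cast
    rw [Int.mul_add_emod_self_left]

theorem exists_desubst_hull (hprim : ρ.IsPrimitive) {x : ℤ → A} (hx : x ∈ ρ.hull.carrier) :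
    ∃ r : ℤ, ∃ y ∈ ρ.hull.carrier, x = shift r (inflateConfig L (columnPerm hL hbij) y) := by
  have hL' : (0 : ℤ) < L := by exact_mod_cast hL
  obtain ⟨r, -, hr⟩ : ∃ r ∈ Set.Ico (0 : ℤ) L, ∀ N : ℕ, ∃ (k : ℕ) (a : A) (t : ℤ),
      ∀ i : ℤ, |i| ≤ N → ∃ b, 0 ≤ L * t + r + i ∧
        (ρ.iter k a)[((L * t + r + i) / L).toNat]? = some b ∧
        columnPerm hL hbij ((L * t + r + i) % L) b = x i := by
    refine (Set.finite_Ico _ _).exists_forall_of_antitone ?_ fun N => ?_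
    · rintro m n r hmn ⟨k, a, t, h⟩
      exact ⟨k, a, t, fun i hi => h i (hi.trans (by exact_mod_cast hmn))⟩
    · obtain ⟨k, hk, a, h⟩ := hx (-N) (2 * N + 1)
      obtain ⟨s, hs⟩ := wordAt_infix_iff.1 h
      obtain ⟨k, rfl⟩ := Nat.exists_eq_add_of_le' hk
      refine ⟨(s + N : ℤ) % L, ⟨Int.emod_nonneg _ hL'.ne', Int.emod_lt_of_pos _ hL'⟩,
        k, a, (s + N : ℤ) / L, fun i hi => ?_⟩
      rw [Int.mul_ediv_add_emod]
      rw [abs_le] at hi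
      obtain ⟨j, hj⟩ := Int.eq_ofNat_of_zero_le (show 0 ≤ N + i by omega)
      have hsj := hs j (by omega)
      rw [iter_succ, getElem?_inflate_eq_some hL hbij] at hsj
      obtain ⟨b, hb, hbx⟩ := hsj
      have e : (s + N + i : ℤ) = (s + j : ℕ) := by
        push_cast
        omega
      refine ⟨b, by omega, ?_, ?_⟩
      · rw [e, ← Int.natCast_div, Int.toNat_natCast, hb]
      · rw [e, hbx]
        congr 1
        omega
  have hdiv : ∀ t j : ℤ, L * t + r + (L * j - r) = L * (t + j) := fun t j => by ring
  refine ⟨r, fun j => (columnPerm hL hbij 0).symm (x (L * j - r)), fun n m => ?_, ?_⟩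
  · obtain ⟨k, a, t, h⟩ := hr (|L * n - r| + L * m).toNat
    refine mem_language_of_infix_iter hprim (k := k) (a := a)
      (wordAt_infix_iff.2 ⟨(t + n).toNat, fun i hi => ?_⟩)
    have hb : ∀ i : ℕ, i < m → |L * (n + i) - r| ≤ ((|L * n - r| + L * m).toNat : ℤ) := by
      intro i hi
      have h1 : (0 : ℤ) ≤ L * i := by positivity
      have h2 : (L * i : ℤ) ≤ L * m := by
        have : (i : ℤ) ≤ m := by omega
        gcongr
      rw [Int.toNat_of_nonneg (by positivity),
        show (L * (n + i) - r : ℤ) = (L * n - r) + L * i by ring]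
      refine (abs_add_le _ _).trans ?_
      rw [abs_of_nonneg h1]
      linarith
    have hpos : 0 ≤ t + n := by
      obtain ⟨b, h0, -⟩ := h _ (hb 0 (by omega))
      rw [hdiv] at h0
      simpa using (mul_nonneg_iff_of_pos_left hL').1 h0
    obtain ⟨b, -, h1, h2⟩ := h _ (hb i hi)
    rw [hdiv, Int.mul_ediv_cancel_left _ hL'.ne'] at h1
    rw [hdiv, Int.mul_emod_right] at h2
    rw [← h2, Equiv.symm_apply_apply, ← h1]
    congr 1
    omega
  · ext i
    simp only [shift_apply, inflateConfig]
    set j := (r + i) / (L : ℤ) with hj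
    obtain ⟨k, a, t, h⟩ := hr (max |i| |L * j - r|).toNat
    have hN : ((max |i| |L * j - r|).toNat : ℤ) = max |i| |L * j - r| :=
      Int.toNat_of_nonneg (by positivity)
    rw [hN] at h
    obtain ⟨b, -, h1, h2⟩ := h i (le_max_left _ _)
    obtain ⟨b', -, h1', h2'⟩ := h (L * j - r) (le_max_right _ _)
    rw [hdiv, Int.mul_ediv_cancel_left _ hL'.ne'] at h1'
    rw [hdiv, Int.mul_emod_right] at h2'
    rw [add_assoc, Int.mul_add_ediv_left _ _ hL'.ne', ← hj, h1', Option.some_inj] at h1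
    rw [add_assoc, Int.mul_add_emod_self_left] at h2
    rw [← h2', Equiv.symm_apply_apply, h1, h2]

omit [TopologicalSpace A] [DiscreteTopology A] in
theorem exists_inflateConfig_eq_of_mem_iter (n : ℕ) (x : ℤ → A) {a : A}
    (ha : a ∈ ρ.iter n (x 0)) :
    ∃ i : ℤ, (inflateConfig L (columnPerm hL hbij))^[n] x i = a := by
  obtain ⟨i, hi⟩ := List.mem_iff_getElem?.1 ha
  have hlt := (List.getElem?_eq_some_iff.1 hi).1
  rw [length_iter] at hlt
  rw [getElem?_iter hL hbij n x hlt, Option.some_inj] at hi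
  exact ⟨i, hi⟩

include hL hbij in
theorem mem_closure_orbit_hull (hprim : ρ.IsPrimitive) {x y : ℤ → A} (hx : x ∈ ρ.hull.carrier)
    (hy : y ∈ ρ.hull.carrier) : y ∈ closure (Set.range fun t : ℤ => shift t x) := by
  rw [mem_closure_iff_nhds]
  intro U hU
  obtain ⟨N, hN⟩ := SubshiftZ.exists_window_of_mem_nhds hU
  obtain ⟨k, -, a, h⟩ := hy (-N) (2 * N + 1)
  have hdes := fun x hx => exists_desubst_hull hL hbij hprim (x := x) hx
  obtain ⟨m, -, hm⟩ := hprim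
  obtain ⟨r, z, -, rfl⟩ := exists_hasSeam hL hdes (m + k) hx
  obtain ⟨s, hs⟩ := wordAt_infix_iff.1 (h.trans (ρ.iter_infix_iter_add (hm (z 0) a) k))
  refine ⟨_, hN _ fun i hi => ?_, ⟨s + N - r, rfl⟩⟩
  rw [abs_le] at hi
  obtain ⟨j, hj⟩ := Int.eq_ofNat_of_zero_le (show 0 ≤ N + i by omega)
  have hsj := hs j (by omega)
  have hlt := (List.getElem?_eq_some_iff.1 hsj).1
  rw [length_iter] at hlt
  rw [getElem?_iter hL hbij _ z hlt, Option.some_inj] at hsj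
  beta_reduce
  rw [SubshiftZ.shift_shift, shift_apply, show i = -N + j by omega, ← hsj]
  refine congr_arg _ ?_
  push_cast
  ring

theorem isBijectiveSubstSystem_hull (hL1 : 1 < L) (hprim : ρ.IsPrimitive)
    (haper : SubshiftZ.IsAperiodic ρ.hull) :
    IsBijectiveSubstSystem L (columnPerm hL hbij) ρ.hull.carrier where
  one_lt := hL1
  isClosed := ρ.hull.isClosed
  shift_mem t _ hx := ρ.hull.mapsTo t hx
  inflate_mem _ hx := inflateConfig_mem_hull hL hbij hx
  exists_desubst _ hx := exists_desubst_hull hL hbij hprim hx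
  mem_closure _ hx _ hy := mem_closure_orbit_hull hL hbij hprim hx hy
  aperiodic := haper
  exists_letter := by
    rintro ⟨x, hx⟩ a
    have hdes := fun x hx => exists_desubst_hull hL hbij hprim (x := x) hx
    obtain ⟨m, -, hm⟩ := hprim
    obtain ⟨r, z, -, rfl⟩ := exists_hasSeam hL hdes m hx
    obtain ⟨i, hi⟩ := exists_inflateConfig_eq_of_mem_iter hL hbij m z (hm (z 0) a)
    exact ⟨_, ρ.hull.mapsTo (i - r) hx, by simp [shift_apply, hi]⟩

end Hull

end ConstLengthSubst

namespace SubshiftZ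

variable {A : Type*} [TopologicalSpace A]

theorem coe_σ_zpow_apply (X : Subshift A ℤ) (t : ℤ) (x : X.carrier) :
    ((σ X ^ t) x).1 = shift t x.1 := by
  induction t generalizing x with
  | zero => simp
  | succ n ih =>
    rw [zpow_add_one, Homeomorph.mul_apply, ih, ← shift_shift]
    rfl
  | pred n ih =>
    rw [zpow_sub_one, Homeomorph.mul_apply, ih, sub_eq_add_neg, ← shift_shift]
    rfl

theorem IsReversor.apply_shift {X : Subshift A ℤ} {H : X.carrier ≃ₜ X.carrier}
    (hH : IsReversor X H) (t : ℤ) (x : X.carrier) :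
    (H ⟨shift t x.1, X.mapsTo t x.2⟩).1 = shift (-t) (H x).1 := by
  have h : SemiconjBy H (σ X) (σ X)⁻¹ := mul_inv_eq_iff_eq_mul.1 hH
  have ht := DFunLike.congr_fun (h.zpow_right t).eq x
  rw [inv_zpow', Homeomorph.mul_apply, Homeomorph.mul_apply] at ht
  have hx : (⟨shift t x.1, X.mapsTo t x.2⟩ : X.carrier) = (σ X ^ t) x :=
    Subtype.ext (coe_σ_zpow_apply X t x).symm
  rw [hx, ht, coe_σ_zpow_apply]

end SubshiftZ

theorem mainTheorem8 {A : Type*} [Finite A] [TopologicalSpace A] [DiscreteTopology A]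
    {L : ℕ} (hL : 1 < L) (ρ : ConstLengthSubst A L)
    (hprim : ρ.IsPrimitive) (hbij : ρ.IsBijective) (haper : SubshiftZ.IsAperiodic ρ.hull)
    (H : ρ.hull.carrier ≃ₜ ρ.hull.carrier) (hH : SubshiftZ.IsReversor ρ.hull H) :
    (∃ (π : Equiv.Perm A) (k : ℤ), ∀ x : ρ.hull.carrier,
      (H x).1 = letterExchange π (shift k (basicMirror L x.1))) ∧
    (∃ h : ℤ, SubshiftZ.HasRadiusLE ρ.hull (SubshiftZ.σ ρ.hull ^ h * H) 0) := by
  obtain ⟨π, d, hπ⟩ : ∃ (π : Equiv.Perm A) (d : ℤ), ∀ (x : ρ.hull.carrier) (i : ℤ),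
      (H x).1 i = π (x.1 (d - i)) := by
    by_cases hne : ρ.hull.carrier.Nonempty
    · have hX := ConstLengthSubst.isBijectiveSubstSystem_hull (by omega) hbij hL hprim haper
      exact hX.exists_perm_forall_apply H (fun t x => Subtype.ext (hH.apply_shift t x)) hne
    · exact ⟨1, 0, fun x => absurd ⟨x.1, x.2⟩ hne⟩
  refine ⟨⟨π, if Odd L then -d else 1 - d, fun x => ?_⟩, d, fun x y hxy => ?_⟩
  · ext i
    rw [hπ]
    by_cases h : Odd L
    · simp only [letterExchange, basicMirror, mirror, shift_apply, if_pos h]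
      exact congr_arg (fun j => π (x.1 j)) (by ring)
    · simp only [letterExchange, basicMirror, mirror', shift_apply, if_neg h]
      exact congr_arg (fun j => π (x.1 j)) (by ring)
  · rw [Homeomorph.mul_apply, Homeomorph.mul_apply, SubshiftZ.coe_σ_zpow_apply,
      SubshiftZ.coe_σ_zpow_apply, shift_apply, shift_apply, hπ, hπ, hxy _ (by simp)]
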